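/- Let $f$ be a Rademacher random multiplicative function, that is, $(f(p))_{p\ \mathrm{prime}}$ are independent random variables, each equal to $+1$ or $-1$ with probability $1/2$, and $f(n)=\mu^2(n)\prod_{p\mid n}f(p)$ for every positive integer $n$, where $\mu$ is the Möbius function. Let $\delta>0$ and $\theta\in(0,1)$ be fixed. Then there exists $\sigma_0\in(1/2,1]$, depending only on $\delta$ and $\theta$, such that for every $\sigma$ with $1/2<\sigma\le\sigma_0$ the following holds. Let $x\ge 1$ be defined by $$\log x=\frac{1}{(\sigma-1/2)^{1/\theta}}.$$ Then the probability that $$\sum_{n\le y}\frac{f(n)}{n^\sigma}>0\quad\text{for all real } y>x$$ is at least $$1-\exp\left(-\frac{1}{2\theta}\,\frac{(\log x)^{2-2\theta}}{(\log\log x)^{1+2\delta}}\right).$$ -/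

import Mathlib

open MeasureTheory ProbabilityTheory

/-- `f` is a Rademacher random multiplicative function on the probability space `(Ω, P)`: its values
at the primes are independent random variables, each equal to `1` or `-1` with probability `1/2`,
and `f n = μ(n) ^ 2 * ∏_{p ∣ n} f p` for every positive integer `n`, where `μ` is the Möbius
function. -/
structure IsRademacherMultiplicative {Ω : Type*} [MeasurableSpace Ω]
    (f : ℕ → Ω → ℝ) (P : Measure Ω) : Prop where
  measurable_prime : ∀ p : ℕ, p.Prime → Measurable (f p)
  indep_prime : iIndepFun (fun (p : Nat.Primes) (ω : Ω) => f (p : ℕ) ω) P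
  prob_one : ∀ p : ℕ, p.Prime → P {ω | f p ω = 1} = 1 / 2
  prob_neg_one : ∀ p : ℕ, p.Prime → P {ω | f p ω = -1} = 1 / 2
  eq_prod : ∀ n : ℕ, 1 ≤ n → ∀ ω : Ω,
    f n ω = ((ArithmeticFunction.moebius n : ℤ) : ℝ) ^ 2 * ∏ p ∈ n.primeFactors, f p ω

/-- The weighted partial sum `∑_{n ≤ y} f(n) / n ^ σ` over the positive integers `n ≤ y`,
for real `y`, at the outcome `ω`. -/
noncomputable def weightedPartialSum {Ω : Type*} (f : ℕ → Ω → ℝ) (σ y : ℝ) (ω : Ω) : ℝ :=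
  ∑ n ∈ Finset.Icc 1 ⌊y⌋₊, f n ω / (n : ℝ) ^ σ

/-! Write σ = 1/2 + η, L = log x, ℓ = log L and Λ = Lη = L^(1-θ). Restrict to primes below N. The
sum up to y is then the Euler product F = ∏ (1 + f(p) p^(-σ)) minus a tail. Unless F is
exceptionally small or some tail beyond x is exceptionally large, every partial sum is positive. All
bounds are uniform in N, so N can be sent to infinity.

Small F: log F is essentially a sum of independent signs whose variance is O(ℓ). Hence E F^(-l) is
at most exp(O(l + l²)ℓ), and Markov bounds P(F ≤ 2T) (`subsetMean_eulerProd_rpow_neg_le`).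

Large tails: a tail is a Walsh polynomial in the signs, so Bonami's inequality
(`subsetMean_walsh_pow_le`) bounds its 2k-th moment by the k-th power of ∑ (2k)^ω(n) n^(-1-2η).
Rankin's trick (`sum_powerset_weight_le`) makes this sum at most a^(-η) (1 + 1/η)^(2k) beyond a.
Within a dyadic block, chaining over binary intervals (`abs_sub_le_of_dyadic_increments`) reduces
all cut-offs to few increments, whose weights telescope (`subsetMean_blockMoment_le`).

With T = exp(-Λ/16) and k, l of order Λ/ℓ, both failures have probability exp(-cΛ²/ℓ) for an
absolute c (`failure_bound_le_exp`). The claim asks only for Λ²/(2θ ℓ^(1+2δ)), and ℓ^(2δ) absorbs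
the constants. -/

/-! ### Two-point moment inequality -/

theorem choose_two_mul_le (k i : ℕ) : (2 * k).choose (2 * i) ≤ k.choose i * (2 * k) ^ i := by
  induction i with
  | zero => simp
  | succ i ih =>
    rcases Nat.lt_or_ge i k with hik | hik
    · obtain ⟨r, rfl⟩ : ∃ r, k = i + 1 + r := ⟨k - (i + 1), by omega⟩
      set k := i + 1 + r with hk
      have h1 := Nat.choose_succ_right_eq (2 * k) (2 * i)
      have h2 := Nat.choose_succ_right_eq (2 * k) (2 * i + 1)
      have h3 := Nat.choose_succ_right_eq k i
      have e1 : 2 * k - 2 * i = 2 * (r + 1) := by omega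
      have e2 : 2 * k - (2 * i + 1) = 2 * r + 1 := by omega
      have e3 : k - i = r + 1 := by omega
      rw [e1] at h1; rw [e2] at h2; rw [e3] at h3
      have e4 : 2 * (i + 1) = 2 * i + 1 + 1 := by ring
      rw [e4]
      have key : (2 * k).choose (2 * i + 1 + 1) * ((2 * i + 1 + 1) * (2 * i + 1))
          ≤ (k.choose (i + 1) * (2 * k) ^ (i + 1)) * ((2 * i + 1 + 1) * (2 * i + 1)) := by
        calc _ = ((2 * k).choose (2 * i + 1 + 1) * (2 * i + 1 + 1)) * (2 * i + 1) := by ring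
          _ = ((2 * k).choose (2 * i + 1) * (2 * i + 1)) * (2 * r + 1) := by rw [h2]; ring
          _ = (2 * k).choose (2 * i) * (2 * (r + 1) * (2 * r + 1)) := by rw [h1]; ring
          _ ≤ (k.choose i * (2 * k) ^ i) * (2 * (r + 1) * (2 * k)) := by
            gcongr; omega
          _ = (k.choose i * (r + 1)) * (2 * (2 * k) ^ (i + 1)) := by ring
          _ = (k.choose (i + 1) * (2 * k) ^ (i + 1)) * (2 * i + 1 + 1) * 1 := by rw [← h3]; ring
          _ ≤ (k.choose (i + 1) * (2 * k) ^ (i + 1)) * (2 * i + 1 + 1) * (2 * i + 1) := by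
            gcongr; omega
          _ = _ := by ring
      exact Nat.le_of_mul_le_mul_right key (by positivity)
    · rw [Nat.choose_eq_zero_of_lt (by omega)]; exact Nat.zero_le _

theorem sum_range_two_mul_add_one_of_odd_eq_zero (g : ℕ → ℝ) (hg : ∀ i, g (2 * i + 1) = 0)
    (k : ℕ) : ∑ j ∈ Finset.range (2 * k + 1), g j = ∑ i ∈ Finset.range (k + 1), g (2 * i) := by
  induction k with
  | zero => simp
  | succ k ih =>
    rw [Finset.sum_range_succ _ (k + 1), ← ih, show 2 * (k + 1) + 1 = 2 * k + 1 + 1 + 1 by ring,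
      Finset.sum_range_succ, Finset.sum_range_succ, hg, add_zero]
    rfl

/-- Odd powers of `B` cancel, and the even terms are compared coefficient by coefficient through
`choose_two_mul_le`. This is the one-variable case of hypercontractivity. -/
theorem two_point_moment_le (A B : ℝ) (k : ℕ) :
    ((A + B) ^ (2 * k) + (A - B) ^ (2 * k)) / 2 ≤ (A ^ 2 + (2 * k : ℕ) * B ^ 2) ^ k := by
  have h : (A + B) ^ (2 * k) + (A - B) ^ (2 * k)
      = ∑ j ∈ Finset.range (2 * k + 1),
        A ^ (2 * k - j) * (B ^ j + (-B) ^ j) * ((2 * k).choose j : ℝ) := by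
    rw [sub_eq_add_neg, add_comm A B, add_comm A (-B), add_pow, add_pow, ← Finset.sum_add_distrib]
    refine Finset.sum_congr rfl fun j _ => by ring
  rw [h, sum_range_two_mul_add_one_of_odd_eq_zero _ (fun i => by
    rw [Odd.neg_pow ⟨i, rfl⟩]; ring), add_comm (A ^ 2), add_pow, Finset.sum_div]
  refine Finset.sum_le_sum fun i hi => ?_
  have hi' : i ≤ k := by simpa [Nat.lt_succ_iff] using hi
  have hc : ((2 * k).choose (2 * i) : ℝ) ≤ k.choose i * ((2 * k : ℕ) : ℝ) ^ i := by
    exact_mod_cast choose_two_mul_le k i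
  rw [Even.neg_pow ⟨i, by ring⟩, show 2 * k - 2 * i = 2 * (k - i) by omega, pow_mul, pow_mul B,
    mul_pow]
  have : 0 ≤ (A ^ 2) ^ (k - i) * (B ^ 2) ^ i := by positivity
  nlinarith [mul_le_mul_of_nonneg_left hc this]

/-! ### Averages over the sign cube and hypercontractivity -/

/-- The mean of `g` over the subsets of `S`. -/
noncomputable def subsetMean (S : Finset ℕ) (g : Finset ℕ → ℝ) : ℝ :=
  (∑ t ∈ S.powerset, g t) / 2 ^ S.card

/-- The Walsh function of `u` at the sign pattern that is `1` on `t` and `-1` off `t`. -/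
noncomputable def walsh (t u : Finset ℕ) : ℝ := ∏ p ∈ u, if p ∈ t then 1 else -1

theorem subsetMean_add (S : Finset ℕ) (g h : Finset ℕ → ℝ) :
    subsetMean S (fun t => g t + h t) = subsetMean S g + subsetMean S h := by
  simp [subsetMean, Finset.sum_add_distrib, add_div]

theorem subsetMean_sum {ι : Type*} (S : Finset ℕ) (I : Finset ι) (g : ι → Finset ℕ → ℝ) :
    subsetMean S (fun t => ∑ i ∈ I, g i t) = ∑ i ∈ I, subsetMean S (g i) := by
  simp only [subsetMean]
  rw [Finset.sum_comm, Finset.sum_div]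

theorem subsetMean_const_mul (S : Finset ℕ) (c : ℝ) (g : Finset ℕ → ℝ) :
    subsetMean S (fun t => c * g t) = c * subsetMean S g := by
  simp only [subsetMean]
  rw [← Finset.mul_sum, mul_div_assoc]

theorem subsetMean_mono {S : Finset ℕ} {g h : Finset ℕ → ℝ}
    (H : ∀ t ∈ S.powerset, g t ≤ h t) : subsetMean S g ≤ subsetMean S h := by
  unfold subsetMean
  gcongr with t ht
  exact H t ht

theorem subsetMean_insert {S : Finset ℕ} {p : ℕ} (hp : p ∉ S) (g : Finset ℕ → ℝ) :
    subsetMean (insert p S) g = subsetMean S (fun t => (g (insert p t) + g t) / 2) := by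
  unfold subsetMean
  rw [Finset.sum_powerset_insert hp, Finset.card_insert_of_notMem hp, ← Finset.sum_div,
    Finset.sum_add_distrib, pow_succ]
  field_simp
  ring

/-- Minkowski's inequality in L^k of the uniform measure on the cube, phrased with k-th powers so
that no roots appear in the applications. -/
theorem subsetMean_pow_add_le (S : Finset ℕ) (f g : Finset ℕ → ℝ) (hf : ∀ t, 0 ≤ f t)
    (hg : ∀ t, 0 ≤ g t) {k : ℕ} (hk : 1 ≤ k) {α β : ℝ} (hα : 0 ≤ α) (hβ : 0 ≤ β)
    (hfα : subsetMean S (fun t => f t ^ k) ≤ α ^ k)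
    (hgβ : subsetMean S (fun t => g t ^ k) ≤ β ^ k) :
    subsetMean S (fun t => (f t + g t) ^ k) ≤ (α + β) ^ k := by
  have hk0 : (k : ℝ) ≠ 0 := by positivity
  have hk0' : k ≠ 0 := by omega
  have M0 : (0 : ℝ) < 2 ^ S.card := by positivity
  have h := Real.Lp_add_le_of_nonneg S.powerset (f := f) (g := g) (p := (k : ℝ))
    (by exact_mod_cast hk) (fun t _ => hf t) (fun t _ => hg t)
  simp only [Real.rpow_natCast] at h
  have bound : ∀ (φ : Finset ℕ → ℝ) (a : ℝ), (∀ t, 0 ≤ φ t) → 0 ≤ a →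
      subsetMean S (fun t => φ t ^ k) ≤ a ^ k →
      (∑ t ∈ S.powerset, φ t ^ k) ^ (1 / (k : ℝ)) ≤ (2 ^ S.card : ℝ) ^ (1 / (k : ℝ)) * a := by
    intro φ a hφ ha h
    rw [subsetMean, div_le_iff₀ M0] at h
    have h0 : 0 ≤ ∑ t ∈ S.powerset, φ t ^ k := Finset.sum_nonneg fun t _ => pow_nonneg (hφ t) _
    calc _ ≤ (a ^ k * 2 ^ S.card) ^ (1 / (k : ℝ)) := Real.rpow_le_rpow h0 h (by positivity)
      _ = _ := by
        rw [Real.mul_rpow (by positivity) (by positivity), mul_comm, one_div,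
          Real.pow_rpow_inv_natCast ha hk0']
  have h1 := h.trans (add_le_add (bound f α hf hα hfα) (bound g β hg hβ hgβ))
  rw [← mul_add] at h1
  have hs : 0 ≤ ∑ t ∈ S.powerset, (f t + g t) ^ k :=
    Finset.sum_nonneg fun t _ => pow_nonneg (add_nonneg (hf t) (hg t)) _
  have h2 := pow_le_pow_left₀ (Real.rpow_nonneg hs _) h1 k
  rw [mul_pow, one_div, Real.rpow_inv_natCast_pow hs hk0',
    Real.rpow_inv_natCast_pow M0.le hk0'] at h2
  rw [subsetMean, div_le_iff₀ M0]
  linarith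

theorem walsh_insert_left {S u : Finset ℕ} {p : ℕ} (hp : p ∉ S) (hu : u ∈ S.powerset)
    (t : Finset ℕ) : walsh (insert p t) u = walsh t u := by
  refine Finset.prod_congr rfl fun q hq => ?_
  have : q ≠ p := by
    rintro rfl
    exact hp (Finset.mem_powerset.1 hu hq)
  simp [Finset.mem_insert, this]

/-- Bonami's hypercontractive moment inequality for Walsh polynomials. -/
theorem subsetMean_walsh_pow_le {k : ℕ} (hk : 1 ≤ k) (S : Finset ℕ) (a : Finset ℕ → ℝ) :
    subsetMean S (fun t => (∑ u ∈ S.powerset, a u * walsh t u) ^ (2 * k))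
      ≤ (∑ u ∈ S.powerset, a u ^ 2 * ((2 * k : ℕ) : ℝ) ^ u.card) ^ k := by
  induction S using Finset.induction_on generalizing a with
  | empty => simp [subsetMean, walsh, pow_mul]
  | insert p S hp ih =>
    set A : Finset ℕ → ℝ := fun t => ∑ u ∈ S.powerset, a u * walsh t u with hA
    set B : Finset ℕ → ℝ := fun t => ∑ u ∈ S.powerset, a (insert p u) * walsh t u with hB
    have hpu : ∀ u ∈ S.powerset, p ∉ u := fun u hu h => hp (Finset.mem_powerset.1 hu h)
    have e1 : ∀ t ∈ S.powerset,
        ∑ u ∈ (insert p S).powerset, a u * walsh t u = A t - B t := by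
      intro t ht
      rw [Finset.sum_powerset_insert hp, hA, hB, sub_eq_add_neg, ← Finset.sum_neg_distrib]
      congr 1
      refine Finset.sum_congr rfl fun u hu => ?_
      have : walsh t (insert p u) = - walsh t u := by
        rw [walsh, Finset.prod_insert (hpu u hu), if_neg (hpu t ht), walsh]; ring
      rw [this]; ring
    have e2 : ∀ t ∈ S.powerset,
        ∑ u ∈ (insert p S).powerset, a u * walsh (insert p t) u = A t + B t := by
      intro t ht
      rw [Finset.sum_powerset_insert hp, hA, hB]
      congr 1
      · exact Finset.sum_congr rfl fun u hu => by rw [walsh_insert_left hp hu]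
      refine Finset.sum_congr rfl fun u hu => ?_
      have : walsh (insert p t) (insert p u) = walsh t u := by
        rw [walsh, Finset.prod_insert (hpu u hu), if_pos (Finset.mem_insert_self _ _), one_mul]
        exact walsh_insert_left hp hu t
      rw [this]
    rw [subsetMean_insert hp]
    -- Averaging over the sign at `p` alone is the two-point inequality. Minkowski then separates `A
    -- ^ 2` from `2k * B ^ 2`, and the induction hypothesis applies to each.
    calc _ ≤ subsetMean S (fun t => (A t ^ 2 + (2 * k : ℕ) * B t ^ 2) ^ k) := by
          refine subsetMean_mono fun t ht => ?_
          rw [e1 t ht, e2 t ht]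
          exact two_point_moment_le _ _ _
      _ ≤ (∑ u ∈ S.powerset, a u ^ 2 * ((2 * k : ℕ) : ℝ) ^ u.card
          + (2 * k : ℕ) * ∑ u ∈ S.powerset, a (insert p u) ^ 2 * ((2 * k : ℕ) : ℝ) ^ u.card) ^ k := by
        refine subsetMean_pow_add_le S _ _ (fun t => by positivity) (fun t => by positivity) hk
          (Finset.sum_nonneg fun u _ => by positivity)
          (mul_nonneg (by positivity) (Finset.sum_nonneg fun u _ => by positivity)) ?_ ?_
        · simpa only [pow_mul] using ih a
        · simp only [mul_pow]
          rw [subsetMean_const_mul]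
          gcongr
          simpa only [pow_mul] using ih (fun u => a (insert p u))
      _ = _ := by
        rw [Finset.sum_powerset_insert hp, Finset.mul_sum]
        congr 2
        refine Finset.sum_congr rfl fun u hu => ?_
        rw [Finset.card_insert_of_notMem (hpu u hu), pow_succ]; ring

/-! ### Power sums and dyadic chaining -/

theorem sum_pow_le_pow_sum_of_nonneg {ι : Type*} (I : Finset ι) (x : ι → ℝ) (hx : ∀ i ∈ I, 0 ≤ x i)
    {k : ℕ} (hk : 1 ≤ k) : ∑ i ∈ I, x i ^ k ≤ (∑ i ∈ I, x i) ^ k := by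
  obtain ⟨k, rfl⟩ : ∃ r, k = r + 1 := ⟨k - 1, by omega⟩
  rw [pow_succ', Finset.sum_mul]
  refine Finset.sum_le_sum fun i hi => ?_
  rw [pow_succ']
  have := hx i hi
  gcongr
  exact Finset.single_le_sum hx hi

/-- Dyadic chaining for the increments of a sequence. -/
theorem abs_sub_le_of_dyadic_increments (G : ℕ → ℝ) (s J : ℕ) (B : ℝ)
    (h : ∀ l < J, ∀ i < 2 ^ (J - l), |G (s + (i + 1) * 2 ^ l) - G (s + i * 2 ^ l)| ≤ B)
    {m : ℕ} (hm : m < 2 ^ J) : |G (s + m) - G s| ≤ J * B := by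
  -- Keep the `r` leading binary digits of `m`: each further digit costs nothing if it is 0 and one
  -- dyadic increment if it is 1.
  have key : ∀ r ≤ J, |G (s + m / 2 ^ (J - r) * 2 ^ (J - r)) - G s| ≤ r * B := by
    intro r
    induction r with
    | zero => intro _; simp [Nat.div_eq_of_lt hm]
    | succ r ih =>
      intro hr
      have ih := ih (by omega)
      set l := J - (r + 1) with hl
      have hl' : J - r = l + 1 := by omega
      rw [hl'] at ih
      have hlJ : l < J := by omega
      set i := m / 2 ^ (l + 1) with hi
      have hdiv : i = m / 2 ^ l / 2 := by rw [hi, pow_succ, Nat.div_div_eq_div_mul]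
      have hB : 0 ≤ B := (abs_nonneg _).trans (h l hlJ 0 (by positivity))
      have hmlt : m / 2 ^ l < 2 ^ (J - l) := by
        rw [Nat.div_lt_iff_lt_mul (by positivity), ← pow_add]
        rwa [Nat.sub_add_cancel hlJ.le]
      rcases Nat.even_or_odd' (m / 2 ^ l) with ⟨c, hc | hc⟩
      · have hci : i = c := by omega
        have : m / 2 ^ l * 2 ^ l = i * 2 ^ (l + 1) := by rw [hc, hci]; ring
        rw [this]; push_cast; linarith
      · have hci : i = c := by omega
        have e1 : m / 2 ^ l * 2 ^ l = (2 * i + 1) * 2 ^ l := by rw [hc, hci]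
        have e2 : i * 2 ^ (l + 1) = (2 * i) * 2 ^ l := by ring
        have h1 := h l hlJ (2 * i) (by omega)
        rw [e2] at ih
        rw [e1]
        calc _ = |(G (s + (2 * i + 1) * 2 ^ l) - G (s + 2 * i * 2 ^ l))
              + (G (s + 2 * i * 2 ^ l) - G s)| := by congr 1; ring
          _ ≤ _ := abs_add_le _ _
          _ ≤ B + r * B := add_le_add h1 ih
          _ = _ := by push_cast; ring
  simpa using key J le_rfl

/-! ### Sums over squarefree numbers and Rankin's trick -/

/-- A telescoping substitute for comparison with an integral; it comes from (1 - 1/q)^(-η) ≥ 1 + η/q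
with q = m + 1. -/
theorem rpow_neg_one_sub_le_sub {η : ℝ} (hη : 0 < η) {m : ℕ} (hm : 1 ≤ m) :
    ((m + 1 : ℕ) : ℝ) ^ (-1 - η)
      ≤ ((m : ℝ) ^ (-η) - ((m + 1 : ℕ) : ℝ) ^ (-η)) / η := by
  have hm0 : (0 : ℝ) < m := by exact_mod_cast hm
  set q : ℝ := ((m + 1 : ℕ) : ℝ) with hq
  have hqm : q = m + 1 := by rw [hq]; push_cast; ring
  have hq0 : 0 < q := by rw [hqm]; linarith
  rw [le_div_iff₀ hη, show -1 - η = -η + -1 by ring, Real.rpow_add hq0, Real.rpow_neg_one]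
  have h1 : (m : ℝ) = q * (1 - q⁻¹) := by rw [mul_sub, mul_inv_cancel₀ hq0.ne', hqm]; ring
  have h0 : 0 < 1 - q⁻¹ := by
    have : 0 < q * (1 - q⁻¹) := h1 ▸ hm0
    exact (mul_pos_iff_of_pos_left hq0).1 this
  have h2 : 1 + η * q⁻¹ ≤ (1 - q⁻¹) ^ (-η) := by
    have h3 : (Real.exp (-q⁻¹)) ^ (-η) ≤ (1 - q⁻¹) ^ (-η) :=
      Real.rpow_le_rpow_of_nonpos h0 (Real.one_sub_le_exp_neg _) (by linarith)
    rw [← Real.exp_mul] at h3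
    have := Real.add_one_le_exp (-q⁻¹ * -η)
    nlinarith
  have h4 : (m : ℝ) ^ (-η) = q ^ (-η) * (1 - q⁻¹) ^ (-η) := by
    conv_lhs => rw [h1]
    exact Real.mul_rpow hq0.le h0.le
  rw [h4]
  have := mul_le_mul_of_nonneg_left h2 (Real.rpow_nonneg hq0.le (-η))
  nlinarith

theorem sum_Icc_rpow_le {η : ℝ} (hη : 0 < η) (M : ℕ) :
    ∑ n ∈ Finset.Icc 1 M, (n : ℝ) ^ (-1 - η) ≤ 1 + 1 / η := by
  rcases Nat.eq_zero_or_pos M with rfl | hM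
  · simp; positivity
  have : ∑ n ∈ Finset.Icc 1 M, (n : ℝ) ^ (-1 - η) ≤ 1 + (1 - (M : ℝ) ^ (-η)) / η := by
    induction M, hM using Nat.le_induction with
    | base => simp
    | succ m hm ih =>
      rw [Finset.sum_Icc_succ_top (by omega)]
      have := rpow_neg_one_sub_le_sub hη hm
      rw [sub_div] at *
      linarith
  refine this.trans ?_
  have : 0 ≤ (M : ℝ) ^ (-η) := by positivity
  gcongr
  linarith

theorem natCast_prod_rpow (u : Finset ℕ) (s : ℝ) :
    ((∏ p ∈ u, p : ℕ) : ℝ) ^ s = ∏ p ∈ u, (p : ℝ) ^ s := by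
  rw [Nat.cast_prod, Real.finsetProd_rpow _ _ fun p _ => Nat.cast_nonneg p]

theorem one_le_prod_of_primes {u : Finset ℕ} (hu : ∀ p ∈ u, p.Prime) : 1 ≤ ∏ p ∈ u, p :=
  Nat.one_le_iff_ne_zero.2 (Finset.prod_ne_zero_iff.2 fun p hp => (hu p hp).ne_zero)

/-- By unique factorisation the products over subsets are distinct positive integers, so the sum is
part of a zeta sum. -/
theorem sum_powerset_prod_rpow_le {S : Finset ℕ} (hS : ∀ p ∈ S, p.Prime) {η : ℝ} (hη : 0 < η) :
    ∑ u ∈ S.powerset, ((∏ p ∈ u, p : ℕ) : ℝ) ^ (-1 - η) ≤ 1 + 1 / η := by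
  have hprime : ∀ u ∈ S.powerset, ∀ p ∈ u, p.Prime := fun u hu p hp =>
    hS p (Finset.mem_powerset.1 hu hp)
  have hinj : Set.InjOn (fun u : Finset ℕ => ∏ p ∈ u, p) S.powerset := by
    intro u hu v hv huv
    rw [← Nat.primeFactors_prod (hprime u hu), ← Nat.primeFactors_prod (hprime v hv)]
    exact congrArg _ huv
  rw [← Finset.sum_image (f := fun n : ℕ => (n : ℝ) ^ (-1 - η)) hinj]
  refine le_trans ?_ (sum_Icc_rpow_le hη (∏ p ∈ S, p))
  refine Finset.sum_le_sum_of_subset_of_nonneg ?_ fun n _ _ => by positivity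
  intro n hn
  obtain ⟨u, hu, rfl⟩ := Finset.mem_image.1 hn
  rw [Finset.mem_Icc]
  exact ⟨one_le_prod_of_primes (hprime u hu), Finset.prod_le_prod_of_subset_of_one_le'
    (Finset.mem_powerset.1 hu) fun p hp _ => (hS p hp).one_lt.le⟩

theorem prod_one_add_rpow_le {S : Finset ℕ} (hS : ∀ p ∈ S, p.Prime) {η : ℝ} (hη : 0 < η) :
    ∏ p ∈ S, (1 + (p : ℝ) ^ (-1 - η)) ≤ 1 + 1 / η := by
  rw [Finset.prod_one_add]
  simpa only [natCast_prod_rpow] using sum_powerset_prod_rpow_le hS hη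

/-- Factor by factor, exp(v/2) ≤ 1 + v on [0, 1]. This controls the variance of the logarithm of the
Euler product without prime number estimates. -/
theorem exp_sum_rpow_div_two_le {S : Finset ℕ} (hS : ∀ p ∈ S, p.Prime) {η : ℝ} (hη : 0 < η) :
    Real.exp ((∑ p ∈ S, (p : ℝ) ^ (-1 - η)) / 2) ≤ 1 + 1 / η := by
  refine le_trans ?_ (prod_one_add_rpow_le hS hη)
  rw [Finset.sum_div, Real.exp_sum]
  refine Finset.prod_le_prod (fun _ _ => (Real.exp_pos _).le) fun p hp => ?_
  set v := (p : ℝ) ^ (-1 - η) with hv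
  have hv0 : 0 ≤ v := by positivity
  have hv1 : v ≤ 1 := Real.rpow_le_one_of_one_le_of_nonpos
    (by exact_mod_cast (hS p hp).one_lt.le) (by linarith)
  have h1 := Real.one_sub_le_exp_neg (v / 2)
  have h2 : Real.exp (v / 2) * Real.exp (-(v / 2)) = 1 := by rw [← Real.exp_add]; simp
  have h3 := mul_le_mul_of_nonneg_left h1 (Real.exp_pos (v / 2)).le
  have h4 : Real.exp (v / 2) * (1 - v / 2) ≤ (1 + v) * (1 - v / 2) := by nlinarith
  exact le_of_mul_le_mul_right h4 (by linarith)

/-- Rankin's bound for the weighted tail of squarefree numbers. -/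
theorem sum_powerset_weight_le {S : Finset ℕ} (hS : ∀ p ∈ S, p.Prime) {η : ℝ} (hη : 0 < η)
    (c : ℕ) {a : ℕ} (ha : 1 ≤ a) :
    ∑ u ∈ S.powerset, (if a ≤ ∏ p ∈ u, p then
        ((∏ p ∈ u, p : ℕ) : ℝ) ^ (-1 - 2 * η) * (c : ℝ) ^ u.card else 0)
      ≤ (a : ℝ) ^ (-η) * (1 + 1 / η) ^ c := by
  have ha0 : (0 : ℝ) < a := by exact_mod_cast ha
  calc _ ≤ ∑ u ∈ S.powerset, (a : ℝ) ^ (-η) *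
        (((∏ p ∈ u, p : ℕ) : ℝ) ^ (-1 - η) * (c : ℝ) ^ u.card) := by
        refine Finset.sum_le_sum fun u hu => ?_
        split_ifs with h
        · have h' : (a : ℝ) ≤ ((∏ p ∈ u, p : ℕ) : ℝ) := by exact_mod_cast h
          -- Half of the excess exponent 2η buys the decay in `a`; the other half keeps the Euler
          -- product bounded.
          rw [show -1 - 2 * η = -η + (-1 - η) by ring, Real.rpow_add (ha0.trans_le h'), mul_assoc]
          gcongr ?_ * _
          exact Real.rpow_le_rpow_of_nonpos ha0 h' (by linarith)
        · positivity
    _ = (a : ℝ) ^ (-η) * ∏ p ∈ S, (1 + c * (p : ℝ) ^ (-1 - η)) := by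
        rw [← Finset.mul_sum, Finset.prod_one_add]
        congr 1
        refine Finset.sum_congr rfl fun u _ => ?_
        rw [natCast_prod_rpow, Finset.prod_mul_distrib, Finset.prod_const, mul_comm]
    _ ≤ (a : ℝ) ^ (-η) * ∏ p ∈ S, (1 + (p : ℝ) ^ (-1 - η)) ^ c := by
        gcongr with p hp
        -- Bernoulli's inequality turns the weight c^ω(n) into the c-th power of the unweighted
        -- product.
        exact one_add_mul_le_pow (by
          have : 0 ≤ (p : ℝ) ^ (-1 - η) := by positivity
          linarith) c
    _ ≤ _ := by
        rw [Finset.prod_pow]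
        gcongr
        exact prod_one_add_rpow_le hS hη

/-! ### Negative moments of random products -/

/-- This is log(1 + v) ≥ v - 4v², valid since |v| ≤ 3/4. The hypothesis on v² still admits v =
±p^(-σ) at p = 2. -/
theorem one_add_rpow_neg_le_exp {v l : ℝ} (hv : v ^ 2 ≤ 1 / 2) (hl : 0 ≤ l) :
    (1 + v) ^ (-l) ≤ Real.exp (4 * l * v ^ 2) * Real.exp (-(l * v)) := by
  have hv1 : |v| ≤ 3 / 4 := abs_le_of_sq_le_sq (by norm_num; linarith) (by norm_num)
  have h := Real.abs_log_sub_add_sum_range_le (x := -v) (by rw [abs_neg]; linarith) 1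
  have hpos : 0 < 1 + v := by linarith [(abs_le.1 hv1).1]
  simp only [Finset.sum_range_one, abs_neg, sub_neg_eq_add] at h
  norm_num at h
  have h2 : v ^ 2 / (1 - |v|) ≤ 4 * v ^ 2 := by
    rw [div_le_iff₀ (by linarith)]
    nlinarith [sq_nonneg v]
  have h3 := (abs_le.1 (h.trans h2)).1
  rw [Real.rpow_def_of_pos hpos, ← Real.exp_add]
  gcongr
  nlinarith

theorem subsetMean_prod_ite (S : Finset ℕ) (x y : ℕ → ℝ) :
    subsetMean S (fun t => ∏ p ∈ S, if p ∈ t then x p else y p) = ∏ p ∈ S, (x p + y p) / 2 := by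
  rw [Finset.prod_div_distrib, Finset.prod_const, Finset.prod_add, subsetMean]
  congr 1
  refine Finset.sum_congr rfl fun t ht => ?_
  have ht := Finset.mem_powerset.1 ht
  rw [← Finset.prod_sdiff ht, mul_comm]
  congr 1
  · exact Finset.prod_congr rfl fun p hp => if_pos hp
  · exact Finset.prod_congr rfl fun p hp => if_neg (Finset.mem_sdiff.1 hp).2

/-- The mean factorises over the primes, and the linear terms average to cosh(l b) ≤ exp(l² b² / 2).
-/
theorem subsetMean_prod_rpow_neg_le (S : Finset ℕ) (b : ℕ → ℝ)
    (hb : ∀ p ∈ S, b p ^ 2 ≤ 1 / 2) {l : ℝ} (hl : 0 ≤ l) :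
    subsetMean S (fun t => (∏ p ∈ S, (1 + (if p ∈ t then 1 else -1) * b p)) ^ (-l))
      ≤ Real.exp ((4 * l + l ^ 2 / 2) * ∑ p ∈ S, b p ^ 2) := by
  have hsq : ∀ p ∈ S, |b p| < 1 := fun p hp =>
    (sq_lt_one_iff_abs_lt_one _).1 (by linarith [hb p hp])
  calc _ ≤ subsetMean S (fun t => ∏ p ∈ S, if p ∈ t then
          Real.exp (4 * l * b p ^ 2) * Real.exp (-(l * b p))
          else Real.exp (4 * l * b p ^ 2) * Real.exp (l * b p)) := by
        refine subsetMean_mono fun t _ => ?_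
        rw [← Real.finsetProd_rpow]
        · refine Finset.prod_le_prod (fun p hp => ?_) fun p hp => ?_
          · have := abs_lt.1 (hsq p hp)
            refine Real.rpow_nonneg ?_ _
            split_ifs <;> linarith
          · split_ifs
            · rw [one_mul]; exact one_add_rpow_neg_le_exp (hb p hp) hl
            · have := one_add_rpow_neg_le_exp (v := -b p) (by rw [neg_sq]; exact hb p hp) hl
              rw [neg_sq, mul_neg, neg_neg] at this
              rwa [neg_one_mul]
        · intro p hp
          have := abs_lt.1 (hsq p hp)
          split_ifs <;> linarith
    _ = ∏ p ∈ S, (Real.exp (4 * l * b p ^ 2) * Real.cosh (l * b p)) := by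
        rw [subsetMean_prod_ite]
        refine Finset.prod_congr rfl fun p _ => ?_
        rw [Real.cosh_eq]; ring
    _ ≤ ∏ p ∈ S, Real.exp ((4 * l + l ^ 2 / 2) * b p ^ 2) := by
        refine Finset.prod_le_prod (fun p _ => by positivity) fun p _ => ?_
        calc _ ≤ Real.exp (4 * l * b p ^ 2) * Real.exp ((l * b p) ^ 2 / 2) := by
              gcongr; exact Real.cosh_le_exp_half_sq _
          _ = _ := by rw [← Real.exp_add]; congr 1; ring
    _ = _ := by rw [← Real.exp_sum, Finset.mul_sum]

/-! ### Moments of tails and increments -/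

/-- The weighted partial sum over the squarefree `n < m` with prime factors in `S`, at the sign
pattern `t`. -/
noncomputable def partialWalsh (S : Finset ℕ) (σ : ℝ) (m : ℕ) (t : Finset ℕ) : ℝ :=
  ∑ u ∈ S.powerset, (if ∏ p ∈ u, p < m then ((∏ p ∈ u, p : ℕ) : ℝ) ^ (-σ) else 0) * walsh t u

/-- The Euler product over `S` at the sign pattern `t`. -/
noncomputable def eulerProd (S : Finset ℕ) (σ : ℝ) (t : Finset ℕ) : ℝ :=
  ∏ p ∈ S, (1 + (if p ∈ t then 1 else -1) * (p : ℝ) ^ (-σ))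

/-- The sum of `c ^ ω(n) / n ^ (1 + 2 η)` over the squarefree `n < m` with prime factors in `S`. -/
noncomputable def weightBelow (S : Finset ℕ) (η : ℝ) (c m : ℕ) : ℝ :=
  ∑ u ∈ S.powerset, if ∏ p ∈ u, p < m then
    ((∏ p ∈ u, p : ℕ) : ℝ) ^ (-1 - 2 * η) * (c : ℝ) ^ u.card else 0

theorem eulerProd_eq_sum (S : Finset ℕ) (σ : ℝ) (t : Finset ℕ) :
    eulerProd S σ t = ∑ u ∈ S.powerset, ((∏ p ∈ u, p : ℕ) : ℝ) ^ (-σ) * walsh t u := by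
  rw [eulerProd, Finset.prod_one_add]
  refine Finset.sum_congr rfl fun u _ => ?_
  rw [natCast_prod_rpow, walsh, ← Finset.prod_mul_distrib]
  exact Finset.prod_congr rfl fun p _ => mul_comm _ _

theorem rpow_neg_half_add_sq (n : ℕ) (η : ℝ) :
    ((n : ℝ) ^ (-(1 / 2 + η))) ^ 2 = (n : ℝ) ^ (-1 - 2 * η) := by
  rw [← Real.rpow_natCast, ← Real.rpow_mul (Nat.cast_nonneg n)]
  congr 1
  push_cast
  ring

theorem subsetMean_tail_pow_le {S : Finset ℕ} (hS : ∀ p ∈ S, p.Prime) {η : ℝ} (hη : 0 < η)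
    {k : ℕ} (hk : 1 ≤ k) {m : ℕ} (hm : 1 ≤ m) :
    subsetMean S (fun t => (eulerProd S (1 / 2 + η) t - partialWalsh S (1 / 2 + η) m t) ^ (2 * k))
      ≤ ((m : ℝ) ^ (-η) * (1 + 1 / η) ^ (2 * k)) ^ k := by
  have h := subsetMean_walsh_pow_le hk S (fun u => if m ≤ ∏ p ∈ u, p then
    ((∏ p ∈ u, p : ℕ) : ℝ) ^ (-(1 / 2 + η)) else 0)
  refine le_trans (le_of_eq ?_) (h.trans ?_)
  · congr 1
    funext t
    rw [eulerProd_eq_sum, partialWalsh, ← Finset.sum_sub_distrib]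
    congr 1
    refine Finset.sum_congr rfl fun u _ => ?_
    by_cases hu : m ≤ ∏ p ∈ u, p
    · rw [if_pos hu, if_neg (not_lt.2 hu)]; ring
    · rw [if_neg hu, if_pos (not_le.1 hu)]; ring
  · refine pow_le_pow_left₀ (Finset.sum_nonneg fun u _ => by positivity)
      (le_trans (le_of_eq ?_) (sum_powerset_weight_le hS hη (2 * k) hm)) k
    refine Finset.sum_congr rfl fun u _ => ?_
    split_ifs
    · rw [rpow_neg_half_add_sq]
    · simp

/-- Bonami's inequality for the terms with a ≤ n < b. The bound stays a difference of `weightBelow`,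
so that it telescopes over adjacent intervals. -/
theorem subsetMean_increment_pow_le (S : Finset ℕ) (η : ℝ) {k : ℕ} (hk : 1 ≤ k) {a b : ℕ}
    (hab : a ≤ b) :
    subsetMean S (fun t =>
        (partialWalsh S (1 / 2 + η) b t - partialWalsh S (1 / 2 + η) a t) ^ (2 * k))
      ≤ (weightBelow S η (2 * k) b - weightBelow S η (2 * k) a) ^ k := by
  have h := subsetMean_walsh_pow_le hk S (fun u => if a ≤ ∏ p ∈ u, p ∧ ∏ p ∈ u, p < b then
    ((∏ p ∈ u, p : ℕ) : ℝ) ^ (-(1 / 2 + η)) else 0)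
  refine le_trans (le_of_eq ?_) (h.trans (le_of_eq ?_))
  · congr 1
    funext t
    rw [partialWalsh, partialWalsh, ← Finset.sum_sub_distrib]
    congr 1
    refine Finset.sum_congr rfl fun u _ => ?_
    rcases lt_or_ge (∏ p ∈ u, p) a with h1 | h1
    · rw [if_pos h1, if_pos (h1.trans_le hab), if_neg (by omega)]; ring
    · rw [if_neg (not_lt.2 h1)]
      simp only [h1, true_and]
      ring
  · rw [weightBelow, weightBelow, ← Finset.sum_sub_distrib]
    congr 1
    refine Finset.sum_congr rfl fun u _ => ?_
    rcases lt_or_ge (∏ p ∈ u, p) a with h1 | h1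
    · rw [if_pos h1, if_pos (h1.trans_le hab), if_neg (by omega)]; ring
    · rw [if_neg (not_lt.2 h1)]
      simp only [h1, true_and, sub_zero]
      split_ifs
      · rw [rpow_neg_half_add_sq]
      · simp

theorem weightBelow_mono (S : Finset ℕ) (η : ℝ) (c : ℕ) : Monotone (weightBelow S η c) := by
  intro a b hab
  refine Finset.sum_le_sum fun u _ => ?_
  split_ifs with h1 h2
  · exact le_rfl
  · exact absurd (h1.trans_le hab) h2
  · positivity
  · exact le_rfl

theorem weightBelow_sub_le {S : Finset ℕ} (hS : ∀ p ∈ S, p.Prime) {η : ℝ} (hη : 0 < η)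
    (c : ℕ) {a : ℕ} (ha : 1 ≤ a) (b : ℕ) :
    weightBelow S η c b - weightBelow S η c a ≤ (a : ℝ) ^ (-η) * (1 + 1 / η) ^ c := by
  refine le_trans ?_ (sum_powerset_weight_le hS hη c ha)
  rw [weightBelow, weightBelow, ← Finset.sum_sub_distrib]
  refine Finset.sum_le_sum fun u _ => ?_
  have : 0 ≤ ((∏ p ∈ u, p : ℕ) : ℝ) ^ (-1 - 2 * η) * (c : ℝ) ^ u.card := by positivity
  rcases lt_or_ge (∏ p ∈ u, p) a with h1 | h1
  · rw [if_pos h1, if_neg (not_le.2 h1)]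
    split_ifs <;> linarith
  · rw [if_neg (not_lt.2 h1), if_pos h1]
    split_ifs <;> linarith

/-! ### Control of a dyadic block -/

/-- The sum of the normalised even moments of the dyadic increments in the block
`[2 ^ j, 2 ^ (j + 1))`, together with that of the tail at `2 ^ j`. -/
noncomputable def blockMoment (S : Finset ℕ) (σ T : ℝ) (k j : ℕ) (t : Finset ℕ) : ℝ :=
  ((eulerProd S σ t - partialWalsh S σ (2 ^ j) t) / T) ^ (2 * k)
    + ∑ l ∈ Finset.range j, ∑ i ∈ Finset.range (2 ^ (j - l)),
      ((partialWalsh S σ (2 ^ j + (i + 1) * 2 ^ l) t - partialWalsh S σ (2 ^ j + i * 2 ^ l) t)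
        / (T / j)) ^ (2 * k)

theorem blockMoment_nonneg (S : Finset ℕ) (σ T : ℝ) (k j : ℕ) (t : Finset ℕ) :
    0 ≤ blockMoment S σ T k j t := by
  refine add_nonneg ((even_two_mul k).pow_nonneg _)
    (Finset.sum_nonneg fun l _ => Finset.sum_nonneg fun i _ => (even_two_mul k).pow_nonneg _)

theorem subsetMean_blockMoment_le {S : Finset ℕ} (hS : ∀ p ∈ S, p.Prime) {η T : ℝ} (hη : 0 < η)
    {k : ℕ} (hk : 1 ≤ k) {j : ℕ} (hj : 1 ≤ j) :
    subsetMean S (blockMoment S (1 / 2 + η) T k j)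
      ≤ 2 * ((j : ℝ) ^ 3 * (((2 ^ j : ℕ) : ℝ) ^ (-η) * (1 + 1 / η) ^ (2 * k)) / T ^ 2) ^ k := by
  set W : ℝ := ((2 ^ j : ℕ) : ℝ) ^ (-η) * (1 + 1 / η) ^ (2 * k) with hW
  have hW0 : 0 ≤ W := by positivity
  have hj1 : (1 : ℝ) ≤ j := by exact_mod_cast hj
  have e : ∀ x y : ℝ, (x / y) ^ (2 * k) = ((y ^ 2)⁻¹) ^ k * x ^ (2 * k) := by
    intro x y
    rw [div_eq_mul_inv, mul_pow, pow_mul y⁻¹, inv_pow]; ring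
  have h1 : subsetMean S (fun t => ((eulerProd S (1 / 2 + η) t
      - partialWalsh S (1 / 2 + η) (2 ^ j) t) / T) ^ (2 * k)) ≤ (W / T ^ 2) ^ k := by
    simp only [e]
    rw [subsetMean_const_mul, div_eq_inv_mul W, mul_pow]
    gcongr
    exact subsetMean_tail_pow_le hS hη hk Nat.one_le_two_pow
  have h2 : ∀ l ∈ Finset.range j, subsetMean S (fun t => ∑ i ∈ Finset.range (2 ^ (j - l)),
      ((partialWalsh S (1 / 2 + η) (2 ^ j + (i + 1) * 2 ^ l) t
        - partialWalsh S (1 / 2 + η) (2 ^ j + i * 2 ^ l) t) / (T / j)) ^ (2 * k))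
      ≤ ((j : ℝ) ^ 2 * W / T ^ 2) ^ k := by
    intro l _
    rw [subsetMean_sum]
    simp only [e]
    simp only [subsetMean_const_mul]
    rw [← Finset.mul_sum, div_pow, inv_div, mul_div_right_comm, mul_pow]
    gcongr
    set w := fun i => weightBelow S η (2 * k) (2 ^ j + i * 2 ^ l) with hw
    have hmono : ∀ i, w i ≤ w (i + 1) := fun i => weightBelow_mono _ _ _ (by gcongr; omega)
    calc _ ≤ ∑ i ∈ Finset.range (2 ^ (j - l)), (w (i + 1) - w i) ^ k :=
          Finset.sum_le_sum fun i _ => subsetMean_increment_pow_le S η hk (by gcongr; omega)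
      -- Moving the power outside the sum lets the weights telescope, so the number of intervals at
      -- a level costs nothing.
      _ ≤ (∑ i ∈ Finset.range (2 ^ (j - l)), (w (i + 1) - w i)) ^ k :=
          sum_pow_le_pow_sum_of_nonneg _ _ (fun i _ => sub_nonneg.2 (hmono i)) hk
      _ ≤ W ^ k := by
          refine pow_le_pow_left₀ (Finset.sum_nonneg fun i _ => sub_nonneg.2 (hmono i)) ?_ k
          rw [Finset.sum_range_sub, hW]
          simpa [hw] using weightBelow_sub_le hS hη (2 * k) (Nat.one_le_two_pow (n := j))
            (2 ^ j + 2 ^ (j - l) * 2 ^ l)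
  have h3 : (W / T ^ 2) ^ k ≤ ((j : ℝ) ^ 3 * W / T ^ 2) ^ k := by
    gcongr
    exact le_mul_of_one_le_left hW0 (one_le_pow₀ hj1)
  -- The normalisation `T / j` costs j² and the j levels of chaining cost at most one more factor j
  -- inside the power.
  have h4 : j * ((j : ℝ) ^ 2 * W / T ^ 2) ^ k ≤ ((j : ℝ) ^ 3 * W / T ^ 2) ^ k := by
    calc _ ≤ (j : ℝ) ^ k * ((j : ℝ) ^ 2 * W / T ^ 2) ^ k := by
          gcongr
          exact le_self_pow₀ hj1 (by omega)
      _ = _ := by rw [← mul_pow]; congr 1; ring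
  calc subsetMean S (blockMoment S (1 / 2 + η) T k j)
      ≤ (W / T ^ 2) ^ k + ∑ l ∈ Finset.range j, ((j : ℝ) ^ 2 * W / T ^ 2) ^ k := by
        unfold blockMoment
        rw [subsetMean_add, subsetMean_sum]
        exact add_le_add h1 (Finset.sum_le_sum h2)
    _ ≤ _ := by
        rw [Finset.sum_const, Finset.card_range, nsmul_eq_mul]
        linarith

/-- Each normalised quantity is below 1, so the tail at `2 ^ j` is below `T` and the j chained
increments add at most `T`; together they cannot cancel an Euler product above `2 * T`. -/
theorem partialWalsh_pos_of_blockMoment_lt_one {S : Finset ℕ} {σ T : ℝ} (hT : 0 < T) {k j : ℕ}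
    {t : Finset ℕ} (hF : 2 * T < eulerProd S σ t) (hb : blockMoment S σ T k j t < 1)
    {M : ℕ} (h1 : 2 ^ j ≤ M) (h2 : M < 2 ^ (j + 1)) : 0 < partialWalsh S σ M t := by
  have habs : ∀ y B : ℝ, 0 < B → (y / B) ^ (2 * k) < 1 → |y| < B := by
    intro y B hB h
    by_contra! hy
    have : 1 ≤ |y / B| := by rw [abs_div, abs_of_pos hB, le_div_iff₀ hB]; linarith
    have h3 := one_le_pow₀ this (n := 2 * k)
    rw [(even_two_mul k).pow_abs] at h3
    linarith
  have hsum : ∀ l ∈ Finset.range j, ∀ i ∈ Finset.range (2 ^ (j - l)),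
      ((partialWalsh S σ (2 ^ j + (i + 1) * 2 ^ l) t - partialWalsh S σ (2 ^ j + i * 2 ^ l) t)
        / (T / j)) ^ (2 * k) < 1 := by
    intro l hl i hi
    refine lt_of_le_of_lt ?_ hb
    refine le_trans ?_ (le_add_of_nonneg_left ((even_two_mul k).pow_nonneg _))
    refine le_trans ?_ (Finset.single_le_sum (f := fun l => ∑ i ∈ Finset.range (2 ^ (j - l)),
      ((partialWalsh S σ (2 ^ j + (i + 1) * 2 ^ l) t - partialWalsh S σ (2 ^ j + i * 2 ^ l) t)
        / (T / j)) ^ (2 * k))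
        (fun l _ => Finset.sum_nonneg fun i _ => (even_two_mul k).pow_nonneg _) hl)
    exact Finset.single_le_sum (f := fun i =>
      ((partialWalsh S σ (2 ^ j + (i + 1) * 2 ^ l) t - partialWalsh S σ (2 ^ j + i * 2 ^ l) t)
        / (T / j)) ^ (2 * k)) (fun i _ => (even_two_mul k).pow_nonneg _) hi
  have htail : |eulerProd S σ t - partialWalsh S σ (2 ^ j) t| < T :=
    habs _ _ hT (lt_of_le_of_lt (le_add_of_nonneg_right (Finset.sum_nonneg fun l _ =>
      Finset.sum_nonneg fun i _ => (even_two_mul k).pow_nonneg _)) hb)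
  obtain ⟨m, rfl⟩ := Nat.exists_eq_add_of_le h1
  have hinc := abs_sub_le_of_dyadic_increments (fun M => partialWalsh S σ M t) (2 ^ j) j (T / j)
    (fun l hl i hi => by
      have hj : (0 : ℝ) < j := by exact_mod_cast (by omega : 0 < j)
      exact (habs _ _ (by positivity)
        (hsum l (Finset.mem_range.2 hl) i (Finset.mem_range.2 hi))).le)
    (m := m) (by rw [pow_succ] at h2; omega)
  -- Only an inequality, because `T / j` is `0` when `j = 0`.
  have : (j : ℝ) * (T / j) ≤ T := by
    rcases eq_or_ne (j : ℝ) 0 with h | h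
    · rw [h, zero_mul]; exact hT.le
    · rw [mul_div_cancel₀ _ h]
  have h5 := (abs_le.1 (hinc.trans this)).1
  have h6 := (abs_lt.1 htail).2
  linarith

/-! ### Small Euler products and the total failure moment -/

theorem eulerProd_pos {S : Finset ℕ} (hS : ∀ p ∈ S, p.Prime) {σ : ℝ} (hσ : 0 < σ)
    (t : Finset ℕ) : 0 < eulerProd S σ t := by
  refine Finset.prod_pos fun p hp => ?_
  have h1 : (p : ℝ) ^ (-σ) < 1 := Real.rpow_lt_one_of_one_lt_of_neg
    (by exact_mod_cast (hS p hp).one_lt) (by linarith)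
  have h0 : 0 ≤ (p : ℝ) ^ (-σ) := by positivity
  split_ifs <;> linarith

theorem subsetMean_eulerProd_rpow_neg_le {S : Finset ℕ} (hS : ∀ p ∈ S, p.Prime) {η : ℝ}
    (hη : 0 < η) {l : ℝ} (hl : 0 ≤ l) :
    subsetMean S (fun t => eulerProd S (1 / 2 + η) t ^ (-l))
      ≤ Real.exp ((4 * l + l ^ 2 / 2) * (2 * Real.log (1 + 1 / (2 * η)))) := by
  refine (subsetMean_prod_rpow_neg_le S (fun p => (p : ℝ) ^ (-(1 / 2 + η))) (fun p hp => ?_)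
    hl).trans ?_
  · have hp2 : (2 : ℝ) ≤ p := by exact_mod_cast (hS p hp).two_le
    rw [rpow_neg_half_add_sq]
    calc (p : ℝ) ^ (-1 - 2 * η) ≤ (p : ℝ) ^ (-1 : ℝ) :=
          Real.rpow_le_rpow_of_exponent_le (by linarith) (by linarith)
      _ ≤ 1 / 2 := by rw [Real.rpow_neg_one, inv_eq_one_div]; gcongr
  · have h := exp_sum_rpow_div_two_le hS (η := 2 * η) (by linarith)
    rw [← Real.le_log_iff_exp_le (by positivity)] at h
    simp only [rpow_neg_half_add_sq]
    gcongr
    linarith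

/-- The total moment that bounds the indicator of a nonpositive partial sum in `[2 ^ j₀, 2 ^ J)`. -/
noncomputable def failureMoment (S : Finset ℕ) (σ T l : ℝ) (k j₀ J : ℕ) (t : Finset ℕ) : ℝ :=
  (2 * T) ^ l * eulerProd S σ t ^ (-l) + ∑ j ∈ Finset.Ico j₀ J, blockMoment S σ T k j t

theorem failureMoment_nonneg {S : Finset ℕ} (hS : ∀ p ∈ S, p.Prime) {σ T l : ℝ} (hσ : 0 < σ)
    (hT : 0 < T) (k j₀ J : ℕ) (t : Finset ℕ) : 0 ≤ failureMoment S σ T l k j₀ J t := by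
  have := eulerProd_pos hS hσ t
  exact add_nonneg (by positivity) (Finset.sum_nonneg fun j _ => blockMoment_nonneg _ _ _ _ _ _)

/-- Either the Euler product is at most `2 * T`, and the first term is at least 1, or the block
containing `M` must have moment at least 1. -/
theorem one_le_failureMoment {S : Finset ℕ} (hS : ∀ p ∈ S, p.Prime) {σ T l : ℝ} (hσ : 0 < σ)
    (hT : 0 < T) (hl : 0 ≤ l) {k j₀ J M : ℕ} {t : Finset ℕ} (h1 : 2 ^ j₀ ≤ M) (h2 : M < 2 ^ J)
    (hM : partialWalsh S σ M t ≤ 0) : 1 ≤ failureMoment S σ T l k j₀ J t := by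
  have hF := eulerProd_pos hS hσ t
  have hs : 0 ≤ ∑ j ∈ Finset.Ico j₀ J, blockMoment S σ T k j t :=
    Finset.sum_nonneg fun j _ => blockMoment_nonneg _ _ _ _ _ _
  rcases le_or_gt (eulerProd S σ t) (2 * T) with h | h
  · refine le_trans ?_ (le_add_of_nonneg_right hs)
    rw [Real.rpow_neg hF.le, ← div_eq_mul_inv, one_le_div (by positivity)]
    exact Real.rpow_le_rpow hF.le h hl
  · have hM0 : M ≠ 0 := (lt_of_lt_of_le (by positivity) h1).ne'
    have hj1 : 2 ^ Nat.log 2 M ≤ M := Nat.pow_log_le_self 2 hM0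
    have hj2 : M < 2 ^ (Nat.log 2 M + 1) := Nat.lt_pow_succ_log_self (by norm_num) M
    have hmem : Nat.log 2 M ∈ Finset.Ico j₀ J := by
      rw [Finset.mem_Ico]
      constructor
      · have := h1.trans_lt hj2
        have := (Nat.pow_lt_pow_iff_right (by norm_num : 1 < 2)).1 this
        omega
      · exact (Nat.pow_lt_pow_iff_right (by norm_num : 1 < 2)).1 (hj1.trans_lt h2)
    have hb : 1 ≤ blockMoment S σ T k (Nat.log 2 M) t := by
      by_contra! hb
      exact absurd (partialWalsh_pos_of_blockMoment_lt_one hT h hb hj1 hj2) (not_lt.2 hM)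
    refine le_trans (hb.trans ?_) (le_add_of_nonneg_left (by positivity))
    exact Finset.single_le_sum (f := fun j => blockMoment S σ T k j t)
      (fun j _ => blockMoment_nonneg _ _ _ _ _ _) hmem

theorem sum_Ico_inv_sq_le_two {j₀ : ℕ} (hj₀ : 1 ≤ j₀) (J : ℕ) :
    ∑ j ∈ Finset.Ico j₀ J, ((j : ℝ) ^ 2)⁻¹ ≤ 2 := by
  calc _ ≤ ∑ j ∈ Finset.Ioo 0 J, ((j : ℝ) ^ 2)⁻¹ := by
        refine Finset.sum_le_sum_of_subset_of_nonneg (fun j hj => ?_) fun j _ _ => by positivity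
        rw [Finset.mem_Ico] at hj
        rw [Finset.mem_Ioo]
        omega
    _ ≤ 2 := by simpa using sum_Ioo_inv_sq_le (α := ℝ) 0 J

theorem two_pow_natCast_rpow (j : ℕ) (s : ℝ) :
    ((2 ^ j : ℕ) : ℝ) ^ s = Real.exp (j * Real.log 2 * s) := by
  rw [Real.rpow_def_of_pos (by positivity)]
  push_cast
  rw [Real.log_pow]

/-- Half of the decay 2^(-jη) pays for j^5: j³ from the block bound and j² for summability over
blocks. The constant is 5! · 4^5, from exp(v) ≥ v^5 / 5! at v = jη/4 and log 2 > 1/2. -/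
theorem pow_five_mul_exp_neg_le {η : ℝ} (hη : 0 < η) (j : ℕ) :
    (j : ℝ) ^ 5 * Real.exp (-(j * Real.log 2 * η / 2)) ≤ 122880 / η ^ 5 := by
  have hlog : 1 / 2 < Real.log 2 := by have := Real.log_two_gt_d9; linarith
  have hv0 : 0 ≤ j * η / 4 := by positivity
  have h := Real.pow_div_factorial_le_exp _ hv0 5
  have h2 : Real.exp (-(j * Real.log 2 * η / 2)) ≤ Real.exp (-(j * η / 4)) := by
    have : 0 ≤ (j : ℝ) * η := by positivity
    exact Real.exp_le_exp.2 (by nlinarith)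
  have h3 : Real.exp (j * η / 4) * Real.exp (-(j * η / 4)) = 1 := by rw [← Real.exp_add]; simp
  have h4 : (Nat.factorial 5 : ℝ) = 120 := by norm_num [Nat.factorial]
  rw [h4] at h
  rw [le_div_iff₀ (by positivity)]
  have h5 : (j : ℝ) ^ 5 * η ^ 5 ≤ 122880 * Real.exp (j * η / 4) := by
    have : (j * η / 4) ^ 5 = (j : ℝ) ^ 5 * η ^ 5 / 1024 := by ring
    rw [this] at h
    linarith
  have h6 := mul_le_mul_of_nonneg_right h5 (Real.exp_pos (-(j * η / 4))).le
  have h7 := mul_le_mul_of_nonneg_left h2 (by positivity : (0 : ℝ) ≤ (j : ℝ) ^ 5 * η ^ 5)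
  nlinarith

theorem subsetMean_failureMoment_le {S : Finset ℕ} (hS : ∀ p ∈ S, p.Prime) {η T l : ℝ}
    (hη : 0 < η) (hT : 0 < T) (hl : 0 ≤ l) {k j₀ : ℕ} (hk : 1 ≤ k) (hj₀ : 1 ≤ j₀) (J : ℕ) :
    subsetMean S (failureMoment S (1 / 2 + η) T l k j₀ J)
      ≤ (2 * T) ^ l * Real.exp ((4 * l + l ^ 2 / 2) * (2 * Real.log (1 + 1 / (2 * η))))
        + 4 * (122880 / η ^ 5 * Real.exp (-(j₀ * Real.log 2 * η / 2)) * (1 + 1 / η) ^ (2 * k)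
          / T ^ 2) ^ k := by
  unfold failureMoment
  rw [subsetMean_add, subsetMean_const_mul, subsetMean_sum]
  set Y : ℝ := 122880 / η ^ 5 * Real.exp (-(j₀ * Real.log 2 * η / 2)) * (1 + 1 / η) ^ (2 * k)
    / T ^ 2 with hY
  have hY0 : 0 ≤ Y := by positivity
  gcongr
  · exact subsetMean_eulerProd_rpow_neg_le hS hη hl
  calc _ ≤ ∑ j ∈ Finset.Ico j₀ J, 2 * (Y ^ k * ((j : ℝ) ^ 2)⁻¹) := by
        refine Finset.sum_le_sum fun j hj => ?_
        rw [Finset.mem_Ico] at hj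
        have hj1 : (1 : ℝ) ≤ j := by exact_mod_cast hj₀.trans hj.1
        have hjj : (j₀ : ℝ) ≤ j := by exact_mod_cast hj.1
        refine (subsetMean_blockMoment_le hS hη hk (hj₀.trans hj.1)).trans ?_
        have hq : ((j : ℝ) ^ 2)⁻¹ ^ k ≤ ((j : ℝ) ^ 2)⁻¹ :=
          pow_le_of_le_one (by positivity) (inv_le_one_of_one_le₀ (one_le_pow₀ hj1)) (by omega)
        have hbase : (j : ℝ) ^ 3 * (((2 ^ j : ℕ) : ℝ) ^ (-η) * (1 + 1 / η) ^ (2 * k)) / T ^ 2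
            ≤ Y * ((j : ℝ) ^ 2)⁻¹ := by
          rw [two_pow_natCast_rpow, show (j : ℝ) * Real.log 2 * -η
            = -(j * Real.log 2 * η / 2) + -(j * Real.log 2 * η / 2) by ring, Real.exp_add]
          have h1 : Real.exp (-(j * Real.log 2 * η / 2)) ≤ Real.exp (-(j₀ * Real.log 2 * η / 2)) := by
            gcongr
          have h2 := pow_five_mul_exp_neg_le hη j
          have h2' : (j : ℝ) ^ 5 * Real.exp (-(j * Real.log 2 * η / 2)) ≤ 122880 / η ^ 5 :=
            h2
          calc _ = ((j : ℝ) ^ 5 * Real.exp (-(j * Real.log 2 * η / 2)))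
                * Real.exp (-(j * Real.log 2 * η / 2)) * (1 + 1 / η) ^ (2 * k) / T ^ 2
                * ((j : ℝ) ^ 2)⁻¹ := by field_simp
            _ ≤ _ := by
                rw [hY]
                gcongr
        calc _ ≤ 2 * (Y * ((j : ℝ) ^ 2)⁻¹) ^ k := by gcongr
          _ ≤ _ := by rw [mul_pow]; gcongr
    _ = 2 * Y ^ k * ∑ j ∈ Finset.Ico j₀ J, ((j : ℝ) ^ 2)⁻¹ := by
        rw [Finset.mul_sum]
        exact Finset.sum_congr rfl fun j _ => by ring
    _ ≤ 2 * Y ^ k * 2 := by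
        gcongr
        exact sum_Ico_inv_sq_le_two hj₀ J
    _ = 4 * Y ^ k := by ring

/-! ### Transfer to the probability space -/

section Transfer

variable {Ω : Type*} [MeasurableSpace Ω] {P : Measure Ω} {f : ℕ → Ω → ℝ}

theorem IsRademacherMultiplicative.ae_eq_one_or [IsProbabilityMeasure P]
    (hf : IsRademacherMultiplicative f P) {p : ℕ} (hp : p.Prime) :
    ∀ᵐ ω ∂P, f p ω = 1 ∨ f p ω = -1 := by
  have hm := hf.measurable_prime p hp
  have h1 : MeasurableSet {ω | f p ω = 1} := hm (measurableSet_singleton 1)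
  have h2 : MeasurableSet {ω | f p ω = -1} := hm (measurableSet_singleton (-1))
  have hd : Disjoint {ω | f p ω = 1} {ω | f p ω = -1} := by
    rw [Set.disjoint_left]
    intro ω h h'
    simp only [Set.mem_ofPred_eq] at h h'
    linarith
  have hu : P ({ω | f p ω = 1} ∪ {ω | f p ω = -1}) = 1 := by
    rw [measure_union hd h2, hf.prob_one p hp, hf.prob_neg_one p hp, ENNReal.add_halves]
  exact (prob_compl_eq_zero_iff (h1.union h2)).2 hu

theorem IsRademacherMultiplicative.measure_signs_eq (hf : IsRademacherMultiplicative f P)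
    {S : Finset ℕ} (hS : ∀ p ∈ S, p.Prime) (t : Finset ℕ) :
    P {ω | ∀ p ∈ S, f p ω = if p ∈ t then 1 else -1} = (1 / 2) ^ S.card := by
  have h := hf.indep_prime.measure_inter_preimage_eq_mul (S.subtype Nat.Prime)
    (sets := fun p => {if (p : ℕ) ∈ t then 1 else -1}) fun p _ => measurableSet_singleton _
  have hset : {ω | ∀ p ∈ S, f p ω = if p ∈ t then 1 else -1}
      = ⋂ p ∈ S.subtype Nat.Prime, (fun ω => f (p : ℕ) ω) ⁻¹' {if (p : ℕ) ∈ t then 1 else -1} := by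
    ext ω
    simp only [Set.mem_ofPred_eq, Set.mem_iInter, Finset.mem_subtype, Set.mem_preimage,
      Set.mem_singleton_iff]
    exact ⟨fun H p hp => H p hp, fun H p hp => H ⟨p, hS p hp⟩ hp⟩
  have hcard : (S.subtype Nat.Prime).card = S.card := by
    rw [Finset.card_subtype, Finset.filter_true_of_mem hS]
  rw [← hcard]
  refine ((congrArg P hset).trans h).trans ?_
  refine Finset.prod_eq_pow_card fun p _ => ?_
  by_cases hpt : (p : ℕ) ∈ t
  · simp only [hpt, if_true]
    exact hf.prob_one p p.2
  · simp only [hpt, if_false]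
    exact hf.prob_neg_one p p.2

/-- Markov's inequality on the finite cube of signs. -/
theorem IsRademacherMultiplicative.measureReal_le_subsetMean [IsProbabilityMeasure P]
    (hf : IsRademacherMultiplicative f P) {S : Finset ℕ} (hS : ∀ p ∈ S, p.Prime)
    {Φ : Finset ℕ → ℝ} (hΦ : ∀ t, 0 ≤ Φ t) {E : Set Ω}
    (hE : ∀ t ∈ S.powerset, ∀ ω ∈ E, (∀ p ∈ S, f p ω = if p ∈ t then 1 else -1) → 1 ≤ Φ t) :
    P.real E ≤ subsetMean S Φ := by
  classical
  set A : Finset ℕ → Set Ω := fun t => {ω | ∀ p ∈ S, f p ω = if p ∈ t then 1 else -1} with hA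
  have hae : ∀ᵐ ω ∂P, ∀ p ∈ S, f p ω = 1 ∨ f p ω = -1 := by
    rw [Filter.eventually_all_finset]
    exact fun p hp => hf.ae_eq_one_or (hS p hp)
  have hAr : ∀ t, P.real (A t) = 1 / 2 ^ S.card := by
    intro t
    rw [Measure.real, hf.measure_signs_eq hS t]
    simp
  have hsub : E ≤ᵐ[P] ⋃ t ∈ S.powerset.filter (fun t => 1 ≤ Φ t), A t := by
    filter_upwards [hae] with ω hω hωE
    have hωA : ∀ p ∈ S, f p ω = if p ∈ S.filter (fun p => f p ω = 1) then 1 else -1 := by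
      intro p hp
      rcases hω p hp with h | h
      · simp [hp, h]
      · have : ¬ ((-1 : ℝ) = 1) := by norm_num
        simp [h, this]
    have hmem : S.filter (fun p => f p ω = 1) ∈ S.powerset :=
      Finset.mem_powerset.2 (Finset.filter_subset _ _)
    exact Set.mem_biUnion (Finset.mem_coe.2 (Finset.mem_filter.2 ⟨hmem, hE _ hmem ω hωE hωA⟩)) hωA
  calc P.real E ≤ P.real (⋃ t ∈ S.powerset.filter (fun t => 1 ≤ Φ t), A t) :=
        ENNReal.toReal_mono (measure_ne_top _ _) (measure_mono_ae hsub)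
    _ ≤ ∑ t ∈ S.powerset.filter (fun t => 1 ≤ Φ t), P.real (A t) := measureReal_biUnion_finset_le _ _
    _ ≤ ∑ t ∈ S.powerset.filter (fun t => 1 ≤ Φ t), Φ t / 2 ^ S.card := by
        refine Finset.sum_le_sum fun t ht => ?_
        rw [hAr]
        gcongr
        exact (Finset.mem_filter.1 ht).2
    _ ≤ ∑ t ∈ S.powerset, Φ t / 2 ^ S.card :=
        Finset.sum_le_sum_of_subset_of_nonneg (Finset.filter_subset _ _) fun t _ _ =>
          div_nonneg (hΦ t) (by positivity)
    _ = subsetMean S Φ := by rw [subsetMean, Finset.sum_div]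

/-- Squarefree n ≤ y correspond to sets of primes below `N` via their prime factors. The `+ 1` is
there because `partialWalsh` cuts off strictly. -/
theorem IsRademacherMultiplicative.weightedPartialSum_eq (hf : IsRademacherMultiplicative f P)
    (σ y : ℝ) {N : ℕ} (hN : ⌊y⌋₊ < N) {ω : Ω} {t : Finset ℕ}
    (hω : ∀ p ∈ N.primesBelow, f p ω = if p ∈ t then 1 else -1) :
    weightedPartialSum f σ y ω = partialWalsh N.primesBelow σ (⌊y⌋₊ + 1) t := by
  set m := ⌊y⌋₊
  have hprime : ∀ u ∈ (N.primesBelow).powerset, ∀ p ∈ u, p.Prime := fun u hu p hp =>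
    Nat.prime_of_mem_primesBelow (Finset.mem_powerset.1 hu hp)
  have h1 : weightedPartialSum f σ y ω
      = ∑ n ∈ (Finset.Icc 1 m).filter Squarefree, f n ω / (n : ℝ) ^ σ := by
    rw [weightedPartialSum, Finset.sum_filter]
    refine Finset.sum_congr rfl fun n hn => ?_
    split_ifs with hsq
    · rfl
    · rw [hf.eq_prod n (Finset.mem_Icc.1 hn).1,
        ArithmeticFunction.moebius_eq_zero_of_not_squarefree hsq]
      simp
  have h2 : partialWalsh N.primesBelow σ (m + 1) t
      = ∑ u ∈ (N.primesBelow).powerset.filter (fun u => ∏ p ∈ u, p < m + 1),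
        ((∏ p ∈ u, p : ℕ) : ℝ) ^ (-σ) * walsh t u := by
    rw [partialWalsh, Finset.sum_filter]
    refine Finset.sum_congr rfl fun u _ => ?_
    split_ifs <;> simp
  rw [h1, h2]
  refine Finset.sum_bij' (fun n _ => n.primeFactors) (fun u _ => ∏ p ∈ u, p) ?_ ?_ ?_ ?_ ?_
  · intro n hn
    obtain ⟨hn, hsq⟩ := Finset.mem_filter.1 hn
    have hn := Finset.mem_Icc.1 hn
    rw [Finset.mem_filter, Finset.mem_powerset, Nat.prod_primeFactors_of_squarefree hsq]
    refine ⟨fun p hp => ?_, by omega⟩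
    exact Nat.mem_primesBelow.2 ⟨((Nat.le_of_mem_primeFactors hp).trans hn.2).trans_lt hN,
      Nat.prime_of_mem_primeFactors hp⟩
  · intro u hu
    obtain ⟨hu, hlt⟩ := Finset.mem_filter.1 hu
    rw [Finset.mem_filter, Finset.mem_Icc]
    refine ⟨⟨one_le_prod_of_primes (hprime u hu), by omega⟩, ?_⟩
    refine Finset.squarefree_prod_of_pairwise_isCoprime ?_ fun p hp => (hprime u hu p hp).squarefree
    intro p hp q hq hpq
    exact Nat.coprime_iff_isRelPrime.1
      ((Nat.coprime_primes (hprime u hu p hp) (hprime u hu q hq)).2 hpq)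
  · intro n hn
    exact Nat.prod_primeFactors_of_squarefree (Finset.mem_filter.1 hn).2
  · intro u hu
    exact Nat.primeFactors_prod (hprime u (Finset.mem_filter.1 hu).1)
  · intro n hn
    obtain ⟨hn, hsq⟩ := Finset.mem_filter.1 hn
    have hn := Finset.mem_Icc.1 hn
    rw [hf.eq_prod n hn.1, Nat.prod_primeFactors_of_squarefree hsq,
      Real.rpow_neg (Nat.cast_nonneg n), div_eq_inv_mul]
    have hmu : ((ArithmeticFunction.moebius n : ℤ) : ℝ) ^ 2 = 1 := by
      exact_mod_cast ArithmeticFunction.moebius_sq_eq_one_of_squarefree hsq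
    rw [hmu, one_mul, walsh]
    congr 1
    refine Finset.prod_congr rfl fun p hp => ?_
    exact hω p (Nat.mem_primesBelow.2 ⟨((Nat.le_of_mem_primeFactors hp).trans hn.2).trans_lt hN,
      Nat.prime_of_mem_primeFactors hp⟩)

/-- The bound does not depend on the truncation `N`, so it passes to the increasing union of the
truncated failure events by continuity from below. -/
theorem IsRademacherMultiplicative.measureReal_nonpos_le [IsProbabilityMeasure P]
    (hf : IsRademacherMultiplicative f P) {η T l x : ℝ} (hη : 0 < η) (hT : 0 < T) (hl : 0 ≤ l)
    {k j₀ : ℕ} (hk : 1 ≤ k) (hj₀ : 1 ≤ j₀) (hx : (2 : ℝ) ^ j₀ ≤ x) :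
    P.real {ω | ∃ y : ℝ, x < y ∧ weightedPartialSum f (1 / 2 + η) y ω ≤ 0}
      ≤ (2 * T) ^ l * Real.exp ((4 * l + l ^ 2 / 2) * (2 * Real.log (1 + 1 / (2 * η))))
        + 4 * (122880 / η ^ 5 * Real.exp (-(j₀ * Real.log 2 * η / 2)) * (1 + 1 / η) ^ (2 * k)
          / T ^ 2) ^ k := by
  set R : ℝ := (2 * T) ^ l * Real.exp ((4 * l + l ^ 2 / 2) * (2 * Real.log (1 + 1 / (2 * η))))
    + 4 * (122880 / η ^ 5 * Real.exp (-(j₀ * Real.log 2 * η / 2)) * (1 + 1 / η) ^ (2 * k)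
          / T ^ 2) ^ k with hR
  have hR0 : 0 ≤ R := by positivity
  set E : ℕ → Set Ω := fun N =>
    {ω | ∃ y : ℝ, x < y ∧ ⌊y⌋₊ < N ∧ weightedPartialSum f (1 / 2 + η) y ω ≤ 0} with hE
  have hmono : Monotone E := by
    rintro a b hab ω ⟨y, h1, h2, h3⟩
    exact ⟨y, h1, h2.trans_le hab, h3⟩
  have hunion : {ω | ∃ y : ℝ, x < y ∧ weightedPartialSum f (1 / 2 + η) y ω ≤ 0} = ⋃ N, E N := by
    ext ω
    simp only [hE, Set.mem_ofPred_eq, Set.mem_iUnion]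
    exact ⟨fun ⟨y, h1, h3⟩ => ⟨⌊y⌋₊ + 1, y, h1, by omega, h3⟩,
      fun ⟨_, y, h1, _, h3⟩ => ⟨y, h1, h3⟩⟩
  have hN : ∀ N, P (E N) ≤ ENNReal.ofReal R := by
    intro N
    have hS : ∀ p ∈ N.primesBelow, p.Prime := fun p hp => Nat.prime_of_mem_primesBelow hp
    rw [← ofReal_measureReal]
    refine ENNReal.ofReal_le_ofReal ?_
    refine (hf.measureReal_le_subsetMean hS
      (Φ := failureMoment N.primesBelow (1 / 2 + η) T l k j₀ (N + 1))
      (failureMoment_nonneg hS (by positivity) hT k j₀ (N + 1)) ?_).trans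
      (subsetMean_failureMoment_le hS hη hT hl hk hj₀ (N + 1))
    rintro t - ω ⟨y, h1, h2, h3⟩ hω
    rw [hf.weightedPartialSum_eq _ _ h2 hω] at h3
    refine one_le_failureMoment hS (by positivity) hT hl (M := ⌊y⌋₊ + 1) ?_ ?_ h3
    · have : ((2 ^ j₀ : ℕ) : ℝ) < ((⌊y⌋₊ + 1 : ℕ) : ℝ) := by
        push_cast
        exact (hx.trans_lt h1).trans (Nat.lt_floor_add_one y)
      exact (Nat.cast_lt.1 this).le
    · exact (Nat.lt_succ_of_le h2).trans Nat.lt_two_pow_self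
  rw [hunion, Measure.real, hmono.measure_iUnion]
  exact ENNReal.toReal_le_of_le_ofReal hR0 (iSup_le hN)

end Transfer

/-! ### Choice of parameters and conclusion -/

theorem failure_bound_le_exp {L θ c : ℝ} (hθ₀ : 0 < θ) (hθ₁ : θ < 1) (hL : 1 ≤ L)
    (hℓ : 12 ≤ Real.log L) (hΛ : 1088 * Real.log L ≤ L ^ (1 - θ)) {η T l : ℝ} {k j₀ : ℕ}
    (hη : η = L ^ (-θ)) (hT : T = Real.exp (-(L ^ (1 - θ) / 16)))
    (hl : l = L ^ (1 - θ) / (64 * Real.log L)) (hk : k = ⌈L ^ (1 - θ) / (32 * Real.log L)⌉₊)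
    (hj₀ : j₀ = ⌊L / Real.log 2⌋₊) (hc : c ≤ L ^ (2 - 2 * θ) / (8192 * Real.log L)) :
    (2 * T) ^ l * Real.exp ((4 * l + l ^ 2 / 2) * (2 * Real.log (1 + 1 / (2 * η))))
        + 4 * (122880 / η ^ 5 * Real.exp (-(j₀ * Real.log 2 * η / 2)) * (1 + 1 / η) ^ (2 * k)
          / T ^ 2) ^ k ≤ Real.exp (-c) := by
  have hL0 : 0 < L := by linarith
  set ℓ := Real.log L with hℓdef
  set Λ := L ^ (1 - θ) with hΛdef
  have hℓ0 : 0 < ℓ := by linarith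
  have hΛ0 : 0 < Λ := by linarith
  have hlog2 : 0 < Real.log 2 := Real.log_pos (by norm_num)
  have hlog2' : Real.log 2 < 1 := by have := Real.log_two_lt_d9; linarith
  have hη' : η = Real.exp (-(θ * ℓ)) := by
    rw [hη, Real.rpow_def_of_pos hL0]; congr 1; ring
  have hη0 : 0 < η := by rw [hη']; positivity
  have hηinv : 1 / η = Real.exp (θ * ℓ) := by rw [hη', Real.exp_neg, one_div, inv_inv]
  have hη1 : 1 / η ≤ Real.exp ℓ := by rw [hηinv]; gcongr; nlinarith
  have hηle : η ≤ 1 := by rw [hη', Real.exp_le_one_iff]; nlinarith [mul_pos hθ₀ hℓ0]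
  have hLη : L * η = Λ := by
    rw [hη, hΛdef, sub_eq_add_neg, Real.rpow_add hL0, Real.rpow_one]
  have hΛsq : L ^ (2 - 2 * θ) = Λ ^ 2 := by
    rw [hΛdef, ← Real.rpow_natCast, ← Real.rpow_mul hL0.le]; congr 1; push_cast; ring
  rw [hΛsq] at hc
  have hexp : Real.exp ℓ + 1 ≤ Real.exp (2 * ℓ) := by
    rw [two_mul, Real.exp_add]
    nlinarith [Real.add_one_le_exp ℓ]
  have hη2 : 1 + 1 / η ≤ Real.exp (2 * ℓ) := by linarith
  have hV : Real.log (1 + 1 / (2 * η)) ≤ 2 * ℓ := by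
    rw [Real.log_le_iff_le_exp (by positivity)]
    have : 1 / (2 * η) ≤ 1 / η := by gcongr; linarith
    linarith
  have hl0 : 0 ≤ l := by rw [hl]; positivity
  have first : (2 * T) ^ l * Real.exp ((4 * l + l ^ 2 / 2) * (2 * Real.log (1 + 1 / (2 * η))))
      ≤ Real.exp (-(Λ ^ 2 / (4096 * ℓ))) := by
    rw [Real.rpow_def_of_pos (by rw [hT]; positivity), ← Real.exp_add, Real.exp_le_exp,
      Real.log_mul (by norm_num) (by rw [hT]; positivity), hT, Real.log_exp]
    have h1 : (4 * l + l ^ 2 / 2) * (2 * Real.log (1 + 1 / (2 * η)))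
        ≤ (4 * l + l ^ 2 / 2) * (2 * (2 * ℓ)) := by gcongr
    have h2 : l * ℓ = Λ / 64 := by rw [hl]; field_simp
    have h3 : Λ ^ 2 / (4096 * ℓ) = l * (Λ / 64) := by rw [hl]; field_simp; norm_num
    have h4 : (Real.log 2 + -(Λ / 16)) * l + (4 * l + l ^ 2 / 2) * (2 * (2 * ℓ))
        = l * (Real.log 2 + 16 * ℓ + 2 * (l * ℓ) - Λ / 16) := by ring
    -- With lℓ = Λ/64 this needs log 2 + 16ℓ ≤ Λ/64, which follows from 17ℓ ≤ Λ/64; hence 1088 = 64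
    -- · 17.
    have h5 : l * (Real.log 2 + 16 * ℓ + 2 * (l * ℓ) - Λ / 16) ≤ l * (-(Λ / 64)) := by
      gcongr
      rw [h2]
      linarith
    rw [h3]
    linarith
  have hk1 : Λ / (32 * ℓ) ≤ k := by rw [hk]; exact Nat.le_ceil _
  have hk2 : (k : ℝ) * ℓ ≤ Λ / 32 + ℓ := by
    have : (k : ℝ) < Λ / (32 * ℓ) + 1 := by rw [hk]; exact Nat.ceil_lt_add_one (by positivity)
    have h := mul_le_mul_of_nonneg_right this.le hℓ0.le
    have e : (Λ / (32 * ℓ) + 1) * ℓ = Λ / 32 + ℓ := by field_simp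
    linarith
  have hj : L - 1 ≤ j₀ * Real.log 2 := by
    have : L / Real.log 2 < j₀ + 1 := by rw [hj₀]; exact Nat.lt_floor_add_one _
    rw [div_lt_iff₀ hlog2] at this
    linarith
  -- The decay exp(-Λ/2) pays Λ/8 for the hypercontractive weight and Λ/8 for `T ^ 2`, leaving Λ/4;
  -- half of that absorbs the factor exp(11ℓ).
  have hY : 122880 / η ^ 5 * Real.exp (-(j₀ * Real.log 2 * η / 2)) * (1 + 1 / η) ^ (2 * k) / T ^ 2
      ≤ Real.exp (-(Λ / 8)) := by
    have a1 : (122880 : ℝ) ≤ Real.exp ℓ := by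
      calc (122880 : ℝ) ≤ 2.7 ^ 12 := by norm_num
        _ ≤ Real.exp 1 ^ 12 := by
          have := Real.exp_one_gt_d9
          gcongr
          linarith
        _ = Real.exp 12 := by rw [← Real.exp_nat_mul]; norm_num
        _ ≤ _ := Real.exp_le_exp.2 hℓ
    have a2 : (1 / η) ^ 5 ≤ Real.exp (5 * ℓ) := by
      calc _ ≤ Real.exp ℓ ^ 5 := by gcongr
        _ = _ := by rw [← Real.exp_nat_mul]; norm_num
    have a3 : Real.exp (-(j₀ * Real.log 2 * η / 2)) ≤ Real.exp (ℓ - Λ / 2) := by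
      gcongr
      have := mul_le_mul_of_nonneg_right hj hη0.le
      rw [sub_mul, hLη] at this
      linarith
    have a4 : (1 + 1 / η) ^ (2 * k) ≤ Real.exp (Λ / 8 + 4 * ℓ) := by
      calc _ ≤ Real.exp (2 * ℓ) ^ (2 * k) := by gcongr
        _ = Real.exp (4 * (k * ℓ)) := by rw [← Real.exp_nat_mul]; congr 1; push_cast; ring
        _ ≤ _ := by gcongr; linarith
    have a5 : (T ^ 2)⁻¹ = Real.exp (Λ / 8) := by
      rw [hT, ← Real.exp_nat_mul, ← Real.exp_neg]; congr 1; push_cast; ring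
    calc _ = 122880 * (1 / η) ^ 5 * Real.exp (-(j₀ * Real.log 2 * η / 2)) * (1 + 1 / η) ^ (2 * k)
          * (T ^ 2)⁻¹ := by rw [one_div_pow]; ring
      _ ≤ Real.exp ℓ * Real.exp (5 * ℓ) * Real.exp (ℓ - Λ / 2) * Real.exp (Λ / 8 + 4 * ℓ)
          * Real.exp (Λ / 8) := by rw [a5]; gcongr
      _ = Real.exp (11 * ℓ - Λ / 4) := by
          rw [← Real.exp_add, ← Real.exp_add, ← Real.exp_add, ← Real.exp_add]; congr 1; ring
      _ ≤ _ := by gcongr; linarith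
  have second : 4 * (122880 / η ^ 5 * Real.exp (-(j₀ * Real.log 2 * η / 2))
      * (1 + 1 / η) ^ (2 * k) / T ^ 2) ^ k ≤ 4 * Real.exp (-(Λ ^ 2 / (4096 * ℓ))) := by
    gcongr
    calc _ ≤ Real.exp (-(Λ / 8)) ^ k := by gcongr
      _ = Real.exp (-(k * (Λ / 8))) := by rw [← Real.exp_nat_mul]; congr 1; ring
      _ ≤ _ := by
        gcongr
        calc Λ ^ 2 / (4096 * ℓ) ≤ Λ ^ 2 / (256 * ℓ) := by gcongr; norm_num
          _ = Λ / (32 * ℓ) * (Λ / 8) := by field_simp; norm_num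
          _ ≤ _ := by gcongr
  -- Half of the exponent Λ²/(4096ℓ) is given up to absorb the factor 5 = 1 + 4.
  have hfive : (5 : ℝ) ≤ Real.exp (Λ ^ 2 / (8192 * ℓ)) := by
    have : 4 ≤ Λ ^ 2 / (8192 * ℓ) := by
      rw [le_div_iff₀ (by positivity)]
      nlinarith
    linarith [Real.add_one_le_exp (Λ ^ 2 / (8192 * ℓ))]
  calc _ ≤ 5 * Real.exp (-(Λ ^ 2 / (4096 * ℓ))) := by linarith
    _ ≤ Real.exp (Λ ^ 2 / (8192 * ℓ)) * Real.exp (-(Λ ^ 2 / (4096 * ℓ))) := by gcongr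
    _ = Real.exp (-(Λ ^ 2 / (8192 * ℓ))) := by
        rw [← Real.exp_add]; congr 1; field_simp; ring
    _ ≤ _ := by gcongr

theorem exists_forall_ge_log_bounds {δ θ : ℝ} (hδ : 0 < δ) (hθ₁ : θ < 1) (K : ℝ) :
    ∃ L₀ : ℝ, 1 ≤ L₀ ∧ ∀ L ≥ L₀, 12 ≤ Real.log L ∧ 1088 * Real.log L ≤ L ^ (1 - θ) ∧
      K ≤ Real.log L ^ (2 * δ) := by
  have h1 : ∀ᶠ L in Filter.atTop, 12 ≤ Real.log L := Real.tendsto_log_atTop.eventually_ge_atTop 12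
  have h2 : ∀ᶠ L in Filter.atTop, K ≤ Real.log L ^ (2 * δ) :=
    ((tendsto_rpow_atTop (by linarith : 0 < 2 * δ)).comp
      Real.tendsto_log_atTop).eventually_ge_atTop K
  have h3 := (isLittleO_log_rpow_atTop (sub_pos.2 hθ₁)).bound (by norm_num : (0 : ℝ) < 1 / 1088)
  obtain ⟨a, ha⟩ := Filter.eventually_atTop.1 ((h1.and h2).and h3)
  refine ⟨max a 1, le_max_right _ _, fun L hL => ?_⟩
  have hL1 : 1 ≤ L := (le_max_right _ _).trans hL
  obtain ⟨⟨b1, b2⟩, b3⟩ := ha L ((le_max_left _ _).trans hL)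
  refine ⟨b1, ?_, b2⟩
  rw [Real.norm_eq_abs, Real.norm_eq_abs, abs_of_nonneg (by linarith),
    abs_of_nonneg (by positivity)] at b3
  linarith

theorem theorem1 (δ θ : ℝ) (hδ : 0 < δ) (hθ₀ : 0 < θ) (hθ₁ : θ < 1) :
    ∃ σ₀ : ℝ, 1 / 2 < σ₀ ∧ σ₀ ≤ 1 ∧
      ∀ (Ω : Type*) [MeasurableSpace Ω] (P : Measure Ω) [IsProbabilityMeasure P]
        (f : ℕ → Ω → ℝ), IsRademacherMultiplicative f P →
      ∀ σ : ℝ, 1 / 2 < σ → σ ≤ σ₀ →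
      ∀ x : ℝ, 1 ≤ x → Real.log x = 1 / (σ - 1 / 2) ^ (1 / θ) →
        1 - Real.exp (-(1 / (2 * θ) *
            ((Real.log x) ^ (2 - 2 * θ) / (Real.log (Real.log x)) ^ (1 + 2 * δ))))
          ≤ P.real {ω | ∀ y : ℝ, x < y → 0 < weightedPartialSum f σ y ω} := by
  -- The value 4096/θ is what makes 1/(2θ ℓ^(1+2δ)) at most 1/(8192ℓ).
  obtain ⟨L₀, hL₀, hbounds⟩ := exists_forall_ge_log_bounds hδ hθ₁ (4096 / θ)
  have hL₀pos : 0 < L₀ := by linarith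
  -- Since η = L^(-θ), the condition η ≤ L₀^(-θ) says L ≥ L₀; the minimum with 1/2 keeps σ₀ ≤ 1.
  refine ⟨1 / 2 + min (1 / 2) (L₀ ^ (-θ)), ?_, ?_, ?_⟩
  · have : 0 < min (1 / 2) (L₀ ^ (-θ)) := lt_min (by norm_num) (by positivity)
    linarith
  · linarith [min_le_left (1 / 2) (L₀ ^ (-θ))]
  intro Ω _ P _ f hf σ hσ hσ₀ x hx hlogx
  obtain ⟨η, rfl⟩ : ∃ η, σ = 1 / 2 + η := ⟨σ - 1 / 2, by ring⟩
  have hη : 0 < η := by linarith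
  have hηle : η ≤ L₀ ^ (-θ) := by linarith [min_le_right (1 / 2) (L₀ ^ (-θ))]
  rw [add_sub_cancel_left, one_div, ← Real.rpow_neg hη.le] at hlogx
  set L := Real.log x with hLdef
  have hL : L₀ ≤ L := by
    rw [hlogx]
    calc L₀ = (L₀ ^ (-θ)) ^ (-(1 / θ)) := by
          rw [← Real.rpow_mul hL₀pos.le, neg_mul_neg, mul_one_div_cancel hθ₀.ne', Real.rpow_one]
      _ ≤ _ := Real.rpow_le_rpow_of_nonpos hη hηle (by
          have : 0 < 1 / θ := by positivity
          linarith)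
  have hηL : η = L ^ (-θ) := by
    rw [hlogx, ← Real.rpow_mul hη.le, neg_mul_neg, one_div_mul_cancel hθ₀.ne', Real.rpow_one]
  obtain ⟨hℓ, hΛ, hK⟩ := hbounds L hL
  have hL1 : 1 ≤ L := hL₀.trans hL
  have hℓ0 : 0 < Real.log L := by linarith
  have hlog2 : 0 < Real.log 2 := Real.log_pos (by norm_num)
  have hlog2' : Real.log 2 < 1 := by have := Real.log_two_lt_d9; linarith
  have hΛ0 : 0 < L ^ (1 - θ) := by positivity
  have hj₀ : 1 ≤ ⌊L / Real.log 2⌋₊ := by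
    rw [Nat.one_le_floor_iff, one_le_div hlog2]
    linarith
  have hx2 : (2 : ℝ) ^ ⌊L / Real.log 2⌋₊ ≤ x := by
    rw [← Real.log_le_log_iff (by positivity) (by linarith), Real.log_pow,
      ← le_div_iff₀ hlog2]
    exact Nat.floor_le (by positivity)
  have hk : 1 ≤ ⌈L ^ (1 - θ) / (32 * Real.log L)⌉₊ := Nat.one_le_ceil_iff.2 (by positivity)
  have hc : 1 / (2 * θ) * (L ^ (2 - 2 * θ) / Real.log L ^ (1 + 2 * δ))
      ≤ L ^ (2 - 2 * θ) / (8192 * Real.log L) := by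
    have hA : 0 < L ^ (2 - 2 * θ) := by positivity
    rw [Real.rpow_add hℓ0, Real.rpow_one]
    rw [div_le_iff₀ hθ₀] at hK
    calc _ = L ^ (2 - 2 * θ) / (2 * (Real.log L ^ (2 * δ) * θ) * Real.log L) := by field_simp
      _ ≤ _ := by
        gcongr
        linarith
  have hbad := (hf.measureReal_nonpos_le hη (Real.exp_pos _)
    (by positivity : 0 ≤ L ^ (1 - θ) / (64 * Real.log L)) hk hj₀ hx2).trans
    (failure_bound_le_exp hθ₀ hθ₁ hL1 hℓ hΛ hηL rfl rfl rfl rfl hc)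
  set good : Set Ω := {ω | ∀ y : ℝ, x < y → 0 < weightedPartialSum f (1 / 2 + η) y ω} with hgood
  set bad : Set Ω := {ω | ∃ y : ℝ, x < y ∧ weightedPartialSum f (1 / 2 + η) y ω ≤ 0} with hbaddef
  -- Subadditivity over this cover replaces the complement rule, so no measurability of `good` is
  -- needed.
  have hcover : good ∪ bad = Set.univ := by
    refine Set.eq_univ_of_forall fun ω => ?_
    by_cases h : ω ∈ good
    · exact Or.inl h
    · refine Or.inr ?_
      simpa [hgood, hbaddef] using h
  have hone : (1 : ℝ) ≤ P.real good + P.real bad := by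
    have := measureReal_union_le (μ := P) good bad
    rwa [hcover, probReal_univ] at this
  linarith
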